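/- Consider a family of instances indexed by $t$, along which $m,n\to\infty$: matrices $M\in[0,1]^{m\times n}$ and integers $1\le \ell\le n$ and $1\le k\le \min(m,n)$, all of which may depend on $t$. Let $s_1(A)\ge s_2(A)\ge\dots\ge 0$ denote the singular values of a real matrix $A$, with $s_i(A)=0$ when $i$ exceeds the number of rows or the number of columns of $A$. Let $M=U\Sigma V^\dagger$ be a singular value decomposition ($U,V$ orthogonal, $\Sigma$ the $m\times n$ rectangular diagonal matrix with diagonal $s_1(M)\ge s_2(M)\ge\cdots$, and $\dagger$ the transpose), and let $U_{1:k}$ be the matrix of the first $k$ columns of $U$. Let the columns of $M$ arrive in uniformly random order (in each round the arriving column is uniform among those that have not arrived yet), and let $M^{(B)}$ be the random $m\times\ell$ matrix of the first $\ell$ arriving columns. Assume that $$s_k(M)^2=\omega\!\left(\frac{mn\log m}{\ell}\right)\qquad\text{and}\qquad \frac{s_k(M)}{s_{k+1}(M)}=\omega(1),$$ where a ratio $a/0$ with $a>0$ is read as $+\infty$. Then, with high probability, $$s_k\big(U_{1:k}U_{1:k}^\dagger M^{(B)}\big)\ \ge\ \sqrt{\frac{\ell}{2n}}\;s_k(M)\qquad\text{and}\qquad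 \frac{s_k\big(U_{1:k}U_{1:k}^\dagger M^{(B)}\big)}{s_1\big((I-U_{1:k}U_{1:k}^\dagger)M^{(B)}\big)}=\omega(1).$$ That is, there is a deterministic $w=w(t)\to\infty$ such that the probability that the first inequality holds and the ratio in the second is at least $w$ tends to $1$. -/

import Mathlib

open Filter Topology Asymptotics
open scoped ENNReal Matrix

noncomputable section

/-- The `i`-th largest singular value `s_i(A)`, indexed from `i = 1`; it is `0` for
`i > min(m, n)`. -/
def sv {m n : ℕ} (A : Matrix (Fin m) (Fin n) ℝ) (i : ℕ) : ℝ :=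
  (Matrix.toEuclideanLin A).singularValues (i - 1)

/-- The matrix `A_{1:k}` made of the first `k` columns of `A`. -/
def firstCols {m n k : ℕ} (A : Matrix (Fin m) (Fin n) ℝ) (h : k ≤ n) :
    Matrix (Fin m) (Fin k) ℝ :=
  A.submatrix id (Fin.castLE h)

/-- `M = U Σ Vᵀ` with `U`, `V` orthogonal and `Σ` the `m × n` rectangular diagonal matrix
with diagonal `s_1(M) ≥ s_2(M) ≥ ⋯`. -/
def IsSVD {m n : ℕ} (M : Matrix (Fin m) (Fin n) ℝ) (U : Matrix (Fin m) (Fin m) ℝ)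
    (V : Matrix (Fin n) (Fin n) ℝ) : Prop :=
  U ∈ Matrix.orthogonalGroup (Fin m) ℝ ∧ V ∈ Matrix.orthogonalGroup (Fin n) ℝ ∧
    M = U * (Matrix.of fun (i : Fin m) (j : Fin n) =>
      if (i : ℕ) = (j : ℕ) then sv M ((i : ℕ) + 1) else 0) * Vᵀ

/-- The orthogonal projection `U_{1:k} U_{1:k}ᵀ`. -/
def topProj {m k : ℕ} (U : Matrix (Fin m) (Fin m) ℝ) (h : k ≤ m) :
    Matrix (Fin m) (Fin m) ℝ :=
  firstCols U h * (firstCols U h)ᵀ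

/-- The batch `M^{(B)}` of the first `ℓ` arriving columns, when the column arriving at
round `j` is the column `σ j` of `M`. -/
def batch {m n ℓ : ℕ} (M : Matrix (Fin m) (Fin n) ℝ) (h : ℓ ≤ n)
    (σ : Equiv.Perm (Fin n)) : Matrix (Fin m) (Fin ℓ) ℝ :=
  firstCols (M.submatrix id σ) h

/-- The probability of an event under a uniformly random arrival order of the `n` columns
(at each round the arriving column is uniform among those that have not arrived yet). -/
def arrivalProb {n : ℕ} (S : Set (Equiv.Perm (Fin n))) : ℝ≥0∞ :=
  (PMF.uniformOfFintype (Equiv.Perm (Fin n))).toOuterMeasure S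

/-- The quotient `a / b` of nonnegative reals in `[0, ∞]`; it is `∞` if `b = 0 < a`
and `0` if `a = b = 0`. -/
def extRatio (a b : ℝ) : ℝ≥0∞ := ENNReal.ofReal a / ENNReal.ofReal b

end

/-! ### Matrix Chernoff bounds without replacement: perturbing one sampled vector. -/

section Concentration

open InnerProductSpace Module

/-! With P the projection onto the span of the first k left singular vectors, the sum of squared
inner products of a vector with the columns of a batch is the quadratic form of a random sum of
rank-one operators. On the k-dimensional space, the columns of U_{1:k}ᵀM have a full sum that is at
least s_k² times the identity. The full sum for (1 - P)M is at most s_{k+1}² times the identity. All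
these columns have squared norm at most m, because M has entries in [0,1]. Two matrix Chernoff
bounds then say that a batch captures about the fraction ℓ/n of each full sum, and the hypothesis on
s_k makes the failure probabilities vanish.

The order is without replacement, so the summands are dependent. Independence is replaced by an
exchange argument. The derivative in s of the trace of exp(sT), summed over all orders, is a sum
over sampled positions of quadratic forms of exp(sT) (`hasDerivAt_traceSum`). Exchanging a sampled
position with an unsampled one preserves the uniform law and changes T by a difference of two
rank-one operators, so the contributions of the two positions agree up to a constant factor when
|s|R is small (`expForm_exchange`, `slotSum_exchange`). The sampled positions therefore carry their
proportional share of the total over all positions, up to that factor, and this total is controlled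
by the full sum. Integrating the resulting differential inequality bounds the trace
(`traceSum_le_of_nonneg`, `traceSum_le_of_nonpos`), and Markov's inequality gives the tails. -/

/-- The chord slope of `exp` is at most the mean of its slopes at the endpoints. -/
theorem sub_mul_exp_sub_exp_le (x y : ℝ) :
    (x - y) * (Real.exp x - Real.exp y) ≤ (x - y) ^ 2 / 2 * (Real.exp x + Real.exp y) := by
  wlog h : y ≤ x generalizing x y
  · have := this y x (le_of_not_ge h)
    nlinarith
  -- This is the trapezoid bound for the convex function exp, normalised to y = 0. Its derivative is
  -- 1 + (u - 1)exp u, nonnegative because exp(-u) ≥ 1 - u.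
  have key : ∀ t : ℝ, 0 ≤ t → 0 ≤ t * (Real.exp t + 1) - 2 * (Real.exp t - 1) := by
    intro t ht
    have hd : ∀ u : ℝ, HasDerivAt (fun u => u * (Real.exp u + 1) - 2 * (Real.exp u - 1))
        (1 * (Real.exp u + 1) + u * Real.exp u - 2 * Real.exp u) u := fun u =>
      ((hasDerivAt_id' u).mul ((Real.hasDerivAt_exp u).add_const 1)).sub
        (((Real.hasDerivAt_exp u).sub_const 1).const_mul 2)
    have hmono : Monotone (fun u : ℝ => u * (Real.exp u + 1) - 2 * (Real.exp u - 1)) := by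
      refine monotone_of_deriv_nonneg (fun u => (hd u).differentiableAt) fun u => ?_
      rw [(hd u).deriv]
      have h1 := Real.add_one_le_exp (-u)
      have h2 : Real.exp u * Real.exp (-u) = 1 := by rw [← Real.exp_add]; simp
      nlinarith [mul_le_mul_of_nonneg_left h1 (Real.exp_pos u).le]
    simpa using hmono ht
  have hk := key (x - y) (sub_nonneg.2 h)
  have hx : Real.exp x = Real.exp (x - y) * Real.exp y := by rw [← Real.exp_add]; simp
  rw [hx]
  have h3 := mul_nonneg (mul_nonneg (sub_nonneg.2 h) (Real.exp_pos y).le) hk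
  nlinarith

variable {E : Type*} [NormedAddCommGroup E] [InnerProductSpace ℝ E]

theorem sum_mul_inner_sq_mul_inner_sq {ι κ : Type*} [Fintype ι] [Fintype κ]
    (c : OrthonormalBasis κ ℝ E) (a : ι → ℝ) (r : ι → ℝ) (u : E) :
    ∑ p, ∑ q, a p * (r p ^ 2 * ⟪c q, u⟫_ℝ ^ 2) = ‖u‖ ^ 2 * ∑ p, a p * r p ^ 2 := by
  have : ∑ q, ⟪c q, u⟫_ℝ ^ 2 = ‖u‖ ^ 2 := by
    simpa using c.sum_sq_norm_inner_right u
  simp_rw [← mul_assoc, ← Finset.mul_sum, this, Finset.mul_sum]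
  exact Finset.sum_congr rfl fun p _ => by ring

variable {α : Type*}

/-- The frame operator `∑ v_{σ i} v_{σ i}ᵀ` of the vectors in the positions `I` of the order
`σ`. -/
noncomputable def frameOp (v : α → E) (I : Finset α) (σ : Equiv.Perm α) : E →ₗ[ℝ] E :=
  ∑ i ∈ I, (rankOne ℝ (v (σ i)) (v (σ i)) : E →L[ℝ] E).toLinearMap

theorem frameOp_apply (v : α → E) (I : Finset α) (σ : Equiv.Perm α) (x : E) :
    frameOp v I σ x = ∑ i ∈ I, ⟪v (σ i), x⟫_ℝ • v (σ i) := by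
  simp [frameOp, LinearMap.sum_apply]

theorem inner_frameOp_self (v : α → E) (I : Finset α) (σ : Equiv.Perm α) (x : E) :
    ⟪x, frameOp v I σ x⟫_ℝ = ∑ i ∈ I, ⟪v (σ i), x⟫_ℝ ^ 2 := by
  rw [frameOp_apply, inner_sum]
  refine Finset.sum_congr rfl fun i _ => ?_
  rw [inner_smul_right, real_inner_comm, sq]

theorem isSymmetric_frameOp (v : α → E) (I : Finset α) (σ : Equiv.Perm α) :
    (frameOp v I σ).IsSymmetric := by
  intro x y
  simp only [frameOp_apply, inner_sum, sum_inner, inner_smul_left, inner_smul_right, conj_trivial]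
  refine Finset.sum_congr rfl fun i _ => ?_
  rw [real_inner_comm x]; ring

/-- Right multiplication by the swap acts on positions, so only the summand at i changes: the vector
at the unsampled position j takes its place. -/
theorem frameOp_swap [DecidableEq α] (v : α → E) (I : Finset α) (σ : Equiv.Perm α) {i j : α}
    (hi : i ∈ I) (hj : j ∉ I) (x : E) :
    frameOp v I σ x - frameOp v I (σ * Equiv.swap i j) x =
      ⟪v (σ i), x⟫_ℝ • v (σ i) - ⟪v (σ j), x⟫_ℝ • v (σ j) := by
  rw [frameOp_apply, frameOp_apply, ← Finset.add_sum_erase I _ hi, ← Finset.add_sum_erase I _ hi]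
  have : ∑ k ∈ I.erase i, ⟪v ((σ * Equiv.swap i j) k), x⟫_ℝ • v ((σ * Equiv.swap i j) k) =
      ∑ k ∈ I.erase i, ⟪v (σ k), x⟫_ℝ • v (σ k) := by
    refine Finset.sum_congr rfl fun k hk => ?_
    have hki : k ≠ i := Finset.ne_of_mem_erase hk
    have hkj : k ≠ j := fun h => hj (h ▸ Finset.mem_of_mem_erase hk)
    simp [Equiv.swap_apply_of_ne_of_ne hki hkj]
  rw [this]
  simp

variable [FiniteDimensional ℝ E]

/-- The quadratic form of `exp (s T)`. -/
noncomputable def expForm {T : E →ₗ[ℝ] E} (hT : T.IsSymmetric) (s : ℝ) (x : E) : ℝ :=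
  ∑ p, Real.exp (s * hT.eigenvalues rfl p) * ⟪hT.eigenvectorBasis rfl p, x⟫_ℝ ^ 2

/-- The trace of `exp (s T)`. -/
noncomputable def expTrace {T : E →ₗ[ℝ] E} (hT : T.IsSymmetric) (s : ℝ) : ℝ :=
  ∑ p, Real.exp (s * hT.eigenvalues rfl p)

theorem expForm_nonneg {T : E →ₗ[ℝ] E} (hT : T.IsSymmetric) (s : ℝ) (x : E) :
    0 ≤ expForm hT s x := by
  unfold expForm; positivity

/-- Mean value trace inequality for `exp (s T)` and `exp (s S)` when `T - S` is
`u uᵀ - v vᵀ`. -/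
theorem expForm_exchange {T S : E →ₗ[ℝ] E} (hT : T.IsSymmetric) (hS : S.IsSymmetric)
    {u v : E} {R : ℝ} (hu : ‖u‖ ^ 2 ≤ R) (hv : ‖v‖ ^ 2 ≤ R)
    (hTS : ∀ x, T x - S x = ⟪u, x⟫_ℝ • u - ⟪v, x⟫_ℝ • v) (s : ℝ) :
    s * (expForm hT s u - expForm hT s v - expForm hS s u + expForm hS s v) ≤
      s ^ 2 * R * (expForm hT s u + expForm hT s v + expForm hS s u + expForm hS s v) := by
  set b := hT.eigenvectorBasis rfl with hb
  set c := hS.eigenvectorBasis rfl with hc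
  set α := hT.eigenvalues rfl with hα
  set β := hS.eigenvalues rfl with hβ
  -- Matrix entries of T - S between an eigenvector of T and one of S, computed in two ways. T and S
  -- need not commute, so two different eigenbases are used.
  have hK : ∀ p q, (α p - β q) * ⟪b p, c q⟫_ℝ =
      ⟪b p, u⟫_ℝ * ⟪c q, u⟫_ℝ - ⟪b p, v⟫_ℝ * ⟪c q, v⟫_ℝ := by
    intro p q
    have h1 : ⟪T (b p), c q⟫_ℝ = α p * ⟪b p, c q⟫_ℝ := by
      rw [hb, hT.apply_eigenvectorBasis rfl p]; simp [inner_smul_left, hα]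
    have h2 : ⟪S (b p), c q⟫_ℝ = β q * ⟪b p, c q⟫_ℝ := by
      rw [hS (b p) (c q), hc, hS.apply_eigenvectorBasis rfl q]; simp [inner_smul_right, hβ]
    rw [sub_mul, ← h1, ← h2, ← inner_sub_left, hTS, inner_sub_left, inner_smul_left,
      inner_smul_left]
    simp only [conj_trivial]
    rw [real_inner_comm (b p) u, real_inner_comm (b p) v, real_inner_comm (c q) u,
      real_inner_comm (c q) v]
  -- Multiplying `hK` by the overlap of the two eigenvectors and summing over one basis (Parseval)
  -- turns a difference of quadratic forms into a double sum. Both exponentials then carry the same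
  -- weights.
  have hTd : expForm hT s u - expForm hT s v = ∑ p, ∑ q, Real.exp (s * α p) *
      ((α p - β q) * ⟪b p, c q⟫_ℝ ^ 2) := by
    unfold expForm
    rw [← Finset.sum_sub_distrib]
    refine Finset.sum_congr rfl fun p _ => ?_
    rw [← Finset.mul_sum, ← mul_sub]
    congr 1
    have h1 := c.sum_inner_mul_inner (b p) u
    have h2 := c.sum_inner_mul_inner (b p) v
    calc ⟪b p, u⟫_ℝ ^ 2 - ⟪b p, v⟫_ℝ ^ 2
        = ⟪b p, u⟫_ℝ * ∑ q, ⟪b p, c q⟫_ℝ * ⟪c q, u⟫_ℝ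
          - ⟪b p, v⟫_ℝ * ∑ q, ⟪b p, c q⟫_ℝ * ⟪c q, v⟫_ℝ := by rw [h1, h2]; ring
      _ = ∑ q, (α p - β q) * ⟪b p, c q⟫_ℝ ^ 2 := by
        rw [Finset.mul_sum, Finset.mul_sum, ← Finset.sum_sub_distrib]
        refine Finset.sum_congr rfl fun q _ => ?_
        linear_combination (-⟪b p, c q⟫_ℝ) * hK p q
  have hSd : expForm hS s u - expForm hS s v = ∑ p, ∑ q, Real.exp (s * β q) *
      ((α p - β q) * ⟪b p, c q⟫_ℝ ^ 2) := by
    unfold expForm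
    rw [← Finset.sum_sub_distrib, Finset.sum_comm]
    refine Finset.sum_congr rfl fun q _ => ?_
    rw [← Finset.mul_sum, ← mul_sub]
    congr 1
    have h1 := b.sum_inner_mul_inner (c q) u
    have h2 := b.sum_inner_mul_inner (c q) v
    calc ⟪c q, u⟫_ℝ ^ 2 - ⟪c q, v⟫_ℝ ^ 2
        = ⟪c q, u⟫_ℝ * ∑ p, ⟪c q, b p⟫_ℝ * ⟪b p, u⟫_ℝ
          - ⟪c q, v⟫_ℝ * ∑ p, ⟪c q, b p⟫_ℝ * ⟪b p, v⟫_ℝ := by rw [h1, h2]; ring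
      _ = ∑ p, (α p - β q) * ⟪b p, c q⟫_ℝ ^ 2 := by
        rw [Finset.mul_sum, Finset.mul_sum, ← Finset.sum_sub_distrib]
        refine Finset.sum_congr rfl fun p _ => ?_
        rw [real_inner_comm (b p) (c q)]
        linear_combination (-⟪b p, c q⟫_ℝ) * hK p q
  have hterm : ∀ p q, s * (Real.exp (s * α p) * ((α p - β q) * ⟪b p, c q⟫_ℝ ^ 2)
        - Real.exp (s * β q) * ((α p - β q) * ⟪b p, c q⟫_ℝ ^ 2)) ≤
      s ^ 2 * (Real.exp (s * α p) * (⟪b p, u⟫_ℝ ^ 2 * ⟪c q, u⟫_ℝ ^ 2)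
        + Real.exp (s * α p) * (⟪b p, v⟫_ℝ ^ 2 * ⟪c q, v⟫_ℝ ^ 2)
        + Real.exp (s * β q) * (⟪c q, u⟫_ℝ ^ 2 * ⟪b p, u⟫_ℝ ^ 2)
        + Real.exp (s * β q) * (⟪c q, v⟫_ℝ ^ 2 * ⟪b p, v⟫_ℝ ^ 2)) := by
    -- The scalar inequality trades the difference of exponentials for (α p - β q)² times their sum.
    -- By `hK` the square is that of a difference of two products, and (x - y)² ≤ 2(x² + y²)
    -- separates u from v.
    intro p q
    have h1 := mul_le_mul_of_nonneg_right (sub_mul_exp_sub_exp_le (s * α p) (s * β q))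
      (sq_nonneg ⟪b p, c q⟫_ℝ)
    have h2 : ((α p - β q) * ⟪b p, c q⟫_ℝ) ^ 2 ≤
        2 * (⟪b p, u⟫_ℝ ^ 2 * ⟪c q, u⟫_ℝ ^ 2 + ⟪b p, v⟫_ℝ ^ 2 * ⟪c q, v⟫_ℝ ^ 2) := by
      rw [hK]
      nlinarith [sq_nonneg (⟪b p, u⟫_ℝ * ⟪c q, u⟫_ℝ + ⟪b p, v⟫_ℝ * ⟪c q, v⟫_ℝ)]
    have h3 := mul_le_mul_of_nonneg_left h2
      (show 0 ≤ s ^ 2 / 2 * (Real.exp (s * α p) + Real.exp (s * β q)) by positivity)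
    calc _ = (s * α p - s * β q) * (Real.exp (s * α p) - Real.exp (s * β q)) *
          ⟪b p, c q⟫_ℝ ^ 2 := by ring
      _ ≤ _ := h1
      _ = s ^ 2 / 2 * (Real.exp (s * α p) + Real.exp (s * β q)) *
          ((α p - β q) * ⟪b p, c q⟫_ℝ) ^ 2 := by ring
      _ ≤ _ := h3
      _ = _ := by ring
  calc s * (expForm hT s u - expForm hT s v - expForm hS s u + expForm hS s v)
      = s * ((expForm hT s u - expForm hT s v) - (expForm hS s u - expForm hS s v)) := by ring
    _ = ∑ p, ∑ q, s * (Real.exp (s * α p) * ((α p - β q) * ⟪b p, c q⟫_ℝ ^ 2)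
        - Real.exp (s * β q) * ((α p - β q) * ⟪b p, c q⟫_ℝ ^ 2)) := by
      rw [hTd, hSd, ← Finset.sum_sub_distrib, Finset.mul_sum]
      refine Finset.sum_congr rfl fun p _ => ?_
      rw [← Finset.sum_sub_distrib, Finset.mul_sum]
    _ ≤ ∑ p, ∑ q, s ^ 2 * (Real.exp (s * α p) * (⟪b p, u⟫_ℝ ^ 2 * ⟪c q, u⟫_ℝ ^ 2)
        + Real.exp (s * α p) * (⟪b p, v⟫_ℝ ^ 2 * ⟪c q, v⟫_ℝ ^ 2)
        + Real.exp (s * β q) * (⟪c q, u⟫_ℝ ^ 2 * ⟪b p, u⟫_ℝ ^ 2)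
        + Real.exp (s * β q) * (⟪c q, v⟫_ℝ ^ 2 * ⟪b p, v⟫_ℝ ^ 2)) :=
      Finset.sum_le_sum fun p _ => Finset.sum_le_sum fun q _ => hterm p q
    _ = s ^ 2 * (‖u‖ ^ 2 * expForm hT s u + ‖v‖ ^ 2 * expForm hT s v +
        ‖u‖ ^ 2 * expForm hS s u + ‖v‖ ^ 2 * expForm hS s v) := by
      simp only [← Finset.mul_sum, Finset.sum_add_distrib]
      congr 1
      congr 1
      · congr 1
        · congr 1
          · simp only [Finset.mul_sum]
            rw [sum_mul_inner_sq_mul_inner_sq c (fun p => Real.exp (s * α p)) (fun p => ⟪b p, u⟫_ℝ) u]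
            rfl
          · simp only [Finset.mul_sum]
            rw [sum_mul_inner_sq_mul_inner_sq c (fun p => Real.exp (s * α p)) (fun p => ⟪b p, v⟫_ℝ) v]
            rfl
        · rw [Finset.sum_comm]
          exact sum_mul_inner_sq_mul_inner_sq b
              (fun p => Real.exp (s * β p)) (fun p => ⟪c p, u⟫_ℝ) u
      · rw [Finset.sum_comm]
        exact sum_mul_inner_sq_mul_inner_sq b
              (fun p => Real.exp (s * β p)) (fun p => ⟪c p, v⟫_ℝ) v
    _ ≤ s ^ 2 * (R * expForm hT s u + R * expForm hT s v +
        R * expForm hS s u + R * expForm hS s v) := by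
      have := expForm_nonneg hT s u
      have := expForm_nonneg hT s v
      have := expForm_nonneg hS s u
      have := expForm_nonneg hS s v
      gcongr
    _ = _ := by ring

theorem eigenvalues_frameOp (v : α → E) (I : Finset α) (σ : Equiv.Perm α)
    (p : Fin (finrank ℝ E)) :
    (isSymmetric_frameOp v I σ).eigenvalues rfl p =
      ∑ i ∈ I, ⟪(isSymmetric_frameOp v I σ).eigenvectorBasis rfl p, v (σ i)⟫_ℝ ^ 2 := by
  have h := inner_frameOp_self v I σ ((isSymmetric_frameOp v I σ).eigenvectorBasis rfl p)
  rw [(isSymmetric_frameOp v I σ).apply_eigenvectorBasis rfl p] at h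
  simp only [RCLike.ofReal_real_eq_id, id_eq, inner_smul_right, real_inner_self_eq_norm_sq,
    OrthonormalBasis.norm_eq_one, one_pow, mul_one] at h
  rw [h]
  simp_rw [real_inner_comm]

/-! ### Averaging over all orders and integrating in s. -/

variable [DecidableEq α] [Fintype α]

/-- The sum over all orders of the quadratic form of `exp (s T)` at the vector in position
`i`. -/
noncomputable def slotSum (v : α → E) (I : Finset α) (s : ℝ) (i : α) : ℝ :=
  ∑ σ : Equiv.Perm α, expForm (isSymmetric_frameOp v I σ) s (v (σ i))

/-- The sum over all orders of the trace of `exp (s T)`. -/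
noncomputable def traceSum (v : α → E) (I : Finset α) (s : ℝ) : ℝ :=
  ∑ σ : Equiv.Perm α, expTrace (isSymmetric_frameOp v I σ) s

/-- Reindexing the orders by the swap of i and j turns the terms of the swapped operator into terms
of the original one with i and j interchanged. Summing `expForm_exchange` over all orders thus gives
twice this inequality. -/
theorem slotSum_exchange (v : α → E) (I : Finset α) {R : ℝ} (hR : ∀ a, ‖v a‖ ^ 2 ≤ R) (s : ℝ)
    {i j : α} (hi : i ∈ I) (hj : j ∉ I) :
    s * (slotSum v I s i - slotSum v I s j) ≤
      s ^ 2 * R * (slotSum v I s i + slotSum v I s j) := by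
  have hre : ∀ k, slotSum v I s k = ∑ σ : Equiv.Perm α,
      expForm (isSymmetric_frameOp v I (σ * Equiv.swap i j)) s (v ((σ * Equiv.swap i j) k)) := by
    intro k
    exact (Equiv.sum_comp (Equiv.mulRight (Equiv.swap i j)) (fun σ : Equiv.Perm α =>
      expForm (isSymmetric_frameOp v I σ) s (v (σ k)))).symm
  have hsum := Finset.sum_le_sum fun (σ : Equiv.Perm α) (_ : σ ∈ Finset.univ) =>
    expForm_exchange (isSymmetric_frameOp v I σ) (isSymmetric_frameOp v I (σ * Equiv.swap i j))
      (hR (σ i)) (hR (σ j)) (frameOp_swap v I σ hi hj) s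
  simp only [← Finset.mul_sum, Finset.sum_add_distrib, Finset.sum_sub_distrib] at hsum
  have h1 := hre i
  have h2 := hre j
  simp only [Equiv.Perm.mul_apply, Equiv.swap_apply_left, Equiv.swap_apply_right] at h1 h2
  rw [← h1, ← h2] at hsum
  have e1 : (∑ σ : Equiv.Perm α, expForm (isSymmetric_frameOp v I σ) s (v (σ i))) =
    slotSum v I s i := rfl
  have e2 : (∑ σ : Equiv.Perm α, expForm (isSymmetric_frameOp v I σ) s (v (σ j))) =
    slotSum v I s j := rfl
  rw [e1, e2] at hsum
  linarith

theorem slotSum_nonneg (v : α → E) (I : Finset α) (s : ℝ) (i : α) : 0 ≤ slotSum v I s i :=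
  Finset.sum_nonneg fun _ _ => expForm_nonneg _ _ _

/-- Summed over all positions, the rank-one operators no longer depend on the order: the randomness
survives only in the exponential, and the full sum can be bounded deterministically. -/
theorem sum_slotSum (v : α → E) (I : Finset α) (s : ℝ) :
    ∑ i, slotSum v I s i = ∑ σ : Equiv.Perm α, ∑ p,
      Real.exp (s * (isSymmetric_frameOp v I σ).eigenvalues rfl p) *
        ∑ a, ⟪v a, (isSymmetric_frameOp v I σ).eigenvectorBasis rfl p⟫_ℝ ^ 2 := by
  unfold slotSum expForm
  rw [Finset.sum_comm]
  refine Finset.sum_congr rfl fun σ _ => ?_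
  rw [Finset.sum_comm]
  refine Finset.sum_congr rfl fun p _ => ?_
  rw [← Finset.mul_sum, ← Equiv.sum_comp σ (fun a => ⟪v a, _⟫_ℝ ^ 2)]
  simp_rw [real_inner_comm]

theorem sum_slotSum_le (v : α → E) (I : Finset α) (s : ℝ) {β : ℝ}
    (hβ : ∀ x, ∑ a, ⟪v a, x⟫_ℝ ^ 2 ≤ β * ‖x‖ ^ 2) :
    ∑ i, slotSum v I s i ≤ β * traceSum v I s := by
  rw [sum_slotSum, traceSum, Finset.mul_sum]
  refine Finset.sum_le_sum fun σ _ => ?_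
  rw [expTrace, Finset.mul_sum]
  refine Finset.sum_le_sum fun p _ => ?_
  have := hβ ((isSymmetric_frameOp v I σ).eigenvectorBasis rfl p)
  rw [OrthonormalBasis.norm_eq_one, one_pow, mul_one] at this
  rw [mul_comm β]
  gcongr

theorem le_sum_slotSum (v : α → E) (I : Finset α) (s : ℝ) {β : ℝ}
    (hβ : ∀ x, β * ‖x‖ ^ 2 ≤ ∑ a, ⟪v a, x⟫_ℝ ^ 2) :
    β * traceSum v I s ≤ ∑ i, slotSum v I s i := by
  rw [sum_slotSum, traceSum, Finset.mul_sum]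
  refine Finset.sum_le_sum fun σ _ => ?_
  rw [expTrace, Finset.mul_sum]
  refine Finset.sum_le_sum fun p _ => ?_
  have := hβ ((isSymmetric_frameOp v I σ).eigenvectorBasis rfl p)
  rw [OrthonormalBasis.norm_eq_one, one_pow, mul_one] at this
  rw [mul_comm β]
  gcongr

/-- The derivative of tr exp(sT) is tr(T exp(sT)). Since T is a sum of rank-one operators, this
trace is the sum of the quadratic forms of exp(sT) at the sampled vectors. -/
theorem hasDerivAt_traceSum (v : α → E) (I : Finset α) (s : ℝ) :
    HasDerivAt (traceSum v I) (∑ i ∈ I, slotSum v I s i) s := by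
  have h : HasDerivAt (traceSum v I) (∑ σ : Equiv.Perm α, ∑ p,
      Real.exp (s * (isSymmetric_frameOp v I σ).eigenvalues rfl p) *
        (1 * (isSymmetric_frameOp v I σ).eigenvalues rfl p)) s := by
    unfold traceSum expTrace
    exact HasDerivAt.fun_sum fun σ _ => HasDerivAt.fun_sum fun p _ =>
      ((hasDerivAt_id' s).mul_const _).exp
  convert h using 1
  unfold slotSum expForm
  rw [Finset.sum_comm]
  refine Finset.sum_congr rfl fun σ _ => ?_
  rw [Finset.sum_comm]
  refine Finset.sum_congr rfl fun p _ => ?_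
  rw [one_mul, ← Finset.mul_sum, ← eigenvalues_frameOp]

/-- Markov's inequality in counting form, with the trace dominating each single exponential. The
factor s is kept on both sides of the hypothesis so that its sign selects the tail. -/
theorem exp_mul_card_le_traceSum (v : α → E) (I : Finset α) (s θ : ℝ)
    {B : Finset (Equiv.Perm α)}
    (hB : ∀ σ ∈ B, ∃ p, s * θ ≤ s * (isSymmetric_frameOp v I σ).eigenvalues rfl p) :
    B.card * Real.exp (s * θ) ≤ traceSum v I s := by
  rw [← nsmul_eq_mul, ← Finset.sum_const]
  refine le_trans (Finset.sum_le_sum fun σ hσ => ?_)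
    (Finset.sum_le_univ_sum_of_nonneg fun σ => Finset.sum_nonneg fun p _ => (Real.exp_pos _).le)
  obtain ⟨p, hp⟩ := hB σ hσ
  exact (Real.exp_le_exp.2 hp).trans
    (Finset.single_le_sum (f := fun p => Real.exp
      (s * (isSymmetric_frameOp v I σ).eigenvalues rfl p))
      (fun p _ => (Real.exp_pos _).le) (Finset.mem_univ p))

theorem traceSum_zero (v : α → E) (I : Finset α) :
    traceSum v I 0 = Fintype.card (Equiv.Perm α) * finrank ℝ E := by
  simp [traceSum, expTrace]

/-- Double counting: a termwise comparison on `I ×ˢ Iᶜ` bounds the sum over `I` by its share of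
the total. -/
theorem card_mul_sum_le_of_forall_le {f : α → ℝ} {I : Finset α} {C : ℝ} (hC : 1 ≤ C)
    (hf : ∀ i, 0 ≤ f i) (h : ∀ i ∈ I, ∀ j ∉ I, f i ≤ C * f j) :
    Fintype.card α * ∑ i ∈ I, f i ≤ C * I.card * ∑ i, f i := by
  have h1 : (Iᶜ.card : ℝ) * ∑ i ∈ I, f i ≤ C * I.card * ∑ j ∈ Iᶜ, f j := by
    have := Finset.sum_le_sum fun i (hi : i ∈ I) => Finset.sum_le_sum fun j (hj : j ∈ Iᶜ) =>
      h i hi j (Finset.mem_compl.1 hj)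
    simp only [Finset.sum_const, nsmul_eq_mul, ← Finset.mul_sum] at this
    linarith
  have h2 : (Fintype.card α : ℝ) = I.card + Iᶜ.card := by
    exact_mod_cast (Finset.card_add_card_compl I).symm
  rw [h2, ← Finset.sum_add_sum_compl I f]
  -- The pairs inside I are compared with factor 1, which is where 1 ≤ C enters.
  have h3 : 0 ≤ (I.card : ℝ) * ∑ i ∈ I, f i :=
    mul_nonneg (Nat.cast_nonneg _) (Finset.sum_nonneg fun i _ => hf i)
  nlinarith

theorem card_mul_sum_ge_of_forall_le {f : α → ℝ} {I : Finset α} {C : ℝ} (hC : 1 ≤ C)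
    (hf : ∀ i, 0 ≤ f i) (h : ∀ i ∈ I, ∀ j ∉ I, f j ≤ C * f i) :
    I.card * ∑ i, f i ≤ C * (Fintype.card α * ∑ i ∈ I, f i) := by
  have h1 : (I.card : ℝ) * ∑ j ∈ Iᶜ, f j ≤ C * Iᶜ.card * ∑ i ∈ I, f i := by
    have := Finset.sum_le_sum fun i (hi : i ∈ I) => Finset.sum_le_sum fun j (hj : j ∈ Iᶜ) =>
      h i hi j (Finset.mem_compl.1 hj)
    simp only [Finset.sum_const, nsmul_eq_mul, ← Finset.mul_sum] at this
    linarith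
  have h2 : (Fintype.card α : ℝ) = I.card + Iᶜ.card := by
    exact_mod_cast (Finset.card_add_card_compl I).symm
  rw [h2, ← Finset.sum_add_sum_compl I f]
  have h3 : 0 ≤ (I.card : ℝ) * ∑ i ∈ I, f i :=
    mul_nonneg (Nat.cast_nonneg _) (Finset.sum_nonneg fun i _ => hf i)
  nlinarith

/-- Grönwall's argument: the trace sum F satisfies F' ≤ 3μF on the interval, so F(s)exp(-3μs)
decreases from its value at 0, the number of orders times the dimension. -/
theorem traceSum_le_of_nonneg [Nonempty α] (v : α → E) (I : Finset α) {R β : ℝ} (hR0 : 0 < R)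
    (hR : ∀ a, ‖v a‖ ^ 2 ≤ R) (hβ : ∀ x, ∑ a, ⟪v a, x⟫_ℝ ^ 2 ≤ β * ‖x‖ ^ 2) :
    traceSum v I (1 / (2 * R)) ≤ Fintype.card (Equiv.Perm α) * finrank ℝ E *
      Real.exp (3 * (I.card / Fintype.card α * β) * (1 / (2 * R))) := by
  set μ := (I.card : ℝ) / Fintype.card α * β with hμ
  have hn : (0 : ℝ) < Fintype.card α := by exact_mod_cast Fintype.card_pos
  have hderiv : ∀ s ∈ Set.Ioc 0 (1 / (2 * R)),
      ∑ i ∈ I, slotSum v I s i ≤ 3 * μ * traceSum v I s := by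
    intro s hs
    have hsR : s * R ≤ 1 / 2 := by
      have := mul_le_mul_of_nonneg_right hs.2 hR0.le
      rwa [show 1 / (2 * R) * R = 1 / 2 by field_simp] at this
    -- The factor is (1 + sR)/(1 - sR), at most 3 when sR ≤ 1/2.
    have hcmp : ∀ i ∈ I, ∀ j ∉ I, slotSum v I s i ≤ 3 * slotSum v I s j := by
      intro i hi j hj
      have h1 := slotSum_exchange v I hR s hi hj
      have h2 : slotSum v I s i - slotSum v I s j ≤
          s * R * (slotSum v I s i + slotSum v I s j) :=
        le_of_mul_le_mul_left (by linarith) hs.1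
      nlinarith [slotSum_nonneg v I s i, slotSum_nonneg v I s j]
    have h1 := card_mul_sum_le_of_forall_le (by norm_num) (slotSum_nonneg v I s) hcmp
    have h2 := mul_le_mul_of_nonneg_left (sum_slotSum_le v I s hβ)
      (show (0 : ℝ) ≤ 3 * I.card by positivity)
    rw [hμ]
    field_simp
    linarith
  have hanti : AntitoneOn (fun s => traceSum v I s * Real.exp (-(3 * μ * s)))
      (Set.Icc 0 (1 / (2 * R))) := by
    have hd : ∀ s, HasDerivAt (fun s => traceSum v I s * Real.exp (-(3 * μ * s)))
        ((∑ i ∈ I, slotSum v I s i) * Real.exp (-(3 * μ * s)) +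
          traceSum v I s * (Real.exp (-(3 * μ * s)) * (-(3 * μ * 1)))) s := fun s =>
      (hasDerivAt_traceSum v I s).mul (((hasDerivAt_id' s).const_mul (3 * μ)).neg.exp)
    refine antitoneOn_of_deriv_nonpos (convex_Icc _ _)
      (fun s _ => (hd s).continuousAt.continuousWithinAt)
      (fun s _ => (hd s).differentiableAt.differentiableWithinAt) fun s hs => ?_
    rw [(hd s).deriv]
    rw [interior_Icc] at hs
    have := mul_le_mul_of_nonneg_right (hderiv s (Set.Ioo_subset_Ioc_self hs))
      (Real.exp_pos (-(3 * μ * s))).le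
    linarith
  have hpos : 0 ≤ 1 / (2 * R) := by positivity
  have h := hanti (Set.left_mem_Icc.2 hpos) (Set.right_mem_Icc.2 hpos) hpos
  simp only [mul_zero, neg_zero, Real.exp_zero, mul_one, traceSum_zero] at h
  rw [Real.exp_neg] at h
  rwa [← div_eq_mul_inv, div_le_iff₀ (Real.exp_pos _)] at h

theorem traceSum_le_of_nonpos [Nonempty α] (v : α → E) (I : Finset α) {R β : ℝ} (hR0 : 0 < R)
    (hR : ∀ a, ‖v a‖ ^ 2 ≤ R) (hβ : ∀ x, β * ‖x‖ ^ 2 ≤ ∑ a, ⟪v a, x⟫_ℝ ^ 2) :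
    traceSum v I (-(1 / (10 * R))) ≤ Fintype.card (Equiv.Perm α) * finrank ℝ E *
      Real.exp (-(9 / 11 * (I.card / Fintype.card α * β) * (1 / (10 * R)))) := by
  set μ := (I.card : ℝ) / Fintype.card α * β with hμ
  have hn : (0 : ℝ) < Fintype.card α := by exact_mod_cast Fintype.card_pos
  have hderiv : ∀ s ∈ Set.Ico (-(1 / (10 * R))) 0,
      9 / 11 * μ * traceSum v I s ≤ ∑ i ∈ I, slotSum v I s i := by
    intro s hs
    have hsR : -s * R ≤ 1 / 10 := by
      have := mul_le_mul_of_nonneg_right (neg_le.1 hs.1) hR0.le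
      rwa [show 1 / (10 * R) * R = 1 / 10 by field_simp] at this
    -- Dividing by the negative s reverses the comparison. The shorter range |s|R ≤ 1/10 gives (1 +
    -- 1/10)/(1 - 1/10) = 11/9, so that the rate 9/11 stays above the 1/2 needed in the end.
    have hcmp : ∀ i ∈ I, ∀ j ∉ I, slotSum v I s j ≤ 11 / 9 * slotSum v I s i := by
      intro i hi j hj
      have h1 := slotSum_exchange v I hR s hi hj
      have h2 : slotSum v I s j - slotSum v I s i ≤
          -s * R * (slotSum v I s i + slotSum v I s j) :=
        le_of_mul_le_mul_left (by linarith) (neg_pos.2 hs.2)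
      nlinarith [slotSum_nonneg v I s i, slotSum_nonneg v I s j]
    have h1 := card_mul_sum_ge_of_forall_le (by norm_num) (slotSum_nonneg v I s) hcmp
    have h2 := mul_le_mul_of_nonneg_left (le_sum_slotSum v I s hβ)
      (show (0 : ℝ) ≤ I.card by positivity)
    rw [hμ]
    field_simp
    linarith
  have hmono : MonotoneOn (fun s => traceSum v I s * Real.exp (-(9 / 11 * μ * s)))
      (Set.Icc (-(1 / (10 * R))) 0) := by
    have hd : ∀ s, HasDerivAt (fun s => traceSum v I s * Real.exp (-(9 / 11 * μ * s)))
        ((∑ i ∈ I, slotSum v I s i) * Real.exp (-(9 / 11 * μ * s)) +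
          traceSum v I s * (Real.exp (-(9 / 11 * μ * s)) * (-(9 / 11 * μ * 1)))) s := fun s =>
      (hasDerivAt_traceSum v I s).mul (((hasDerivAt_id' s).const_mul (9 / 11 * μ)).neg.exp)
    refine monotoneOn_of_deriv_nonneg (convex_Icc _ _)
      (fun s _ => (hd s).continuousAt.continuousWithinAt)
      (fun s _ => (hd s).differentiableAt.differentiableWithinAt) fun s hs => ?_
    rw [(hd s).deriv]
    rw [interior_Icc] at hs
    have := mul_le_mul_of_nonneg_right (hderiv s (Set.Ioo_subset_Ico_self hs))
      (Real.exp_pos (-(9 / 11 * μ * s))).le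
    linarith
  have hpos : -(1 / (10 * R)) ≤ 0 := neg_nonpos.2 (by positivity)
  have h := hmono (Set.left_mem_Icc.2 hpos) (Set.right_mem_Icc.2 hpos) hpos
  simp only [mul_zero, neg_zero, Real.exp_zero, mul_one, traceSum_zero] at h
  rw [Real.exp_neg]
  rw [mul_neg, neg_neg] at h
  rwa [← div_eq_mul_inv, le_div_iff₀ (Real.exp_pos _)]

theorem inner_apply_self_eq_sum {T : E →ₗ[ℝ] E} (hT : T.IsSymmetric) (x : E) :
    ⟪x, T x⟫_ℝ = ∑ p, hT.eigenvalues rfl p * ⟪hT.eigenvectorBasis rfl p, x⟫_ℝ ^ 2 := by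
  rw [← (hT.eigenvectorBasis rfl).sum_inner_mul_inner]
  refine Finset.sum_congr rfl fun p _ => ?_
  rw [← hT (hT.eigenvectorBasis rfl p) x, hT.apply_eigenvectorBasis rfl p, inner_smul_left,
    real_inner_comm x]
  simp only [RCLike.ofReal_real_eq_id, id_eq, conj_trivial]
  ring

/-- Matrix Chernoff bound, upper tail, for sampling without replacement. -/
theorem card_not_forall_sum_inner_sq_le [Nonempty α] (v : α → E) (I : Finset α) {R β : ℝ}
    (hR0 : 0 < R) (hR : ∀ a, ‖v a‖ ^ 2 ≤ R) (hβ : ∀ x, ∑ a, ⟪v a, x⟫_ℝ ^ 2 ≤ β * ‖x‖ ^ 2)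
    (θ : ℝ) (B : Finset (Equiv.Perm α))
    (hB : ∀ σ ∈ B, ¬ ∀ x, ∑ i ∈ I, ⟪v (σ i), x⟫_ℝ ^ 2 ≤ θ * ‖x‖ ^ 2) :
    (B.card : ℝ) ≤ Fintype.card (Equiv.Perm α) * (finrank ℝ E *
      Real.exp (-((θ - 3 * (I.card / Fintype.card α * β)) / (2 * R)))) := by
  have h1 := exp_mul_card_le_traceSum v I (1 / (2 * R)) θ (B := B) fun σ hσ => by
    by_contra! hcon
    refine hB σ hσ fun x => ?_
    rw [← inner_frameOp_self, inner_apply_self_eq_sum (isSymmetric_frameOp v I σ)]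
    have hx := ((isSymmetric_frameOp v I σ).eigenvectorBasis rfl).sum_sq_norm_inner_right x
    rw [← hx, Finset.mul_sum]
    refine Finset.sum_le_sum fun p _ => ?_
    rw [Real.norm_eq_abs, sq_abs]
    have := le_of_mul_le_mul_left (hcon p).le (by positivity)
    gcongr
  have h2 := h1.trans (traceSum_le_of_nonneg v I hR0 hR hβ)
  rw [← le_div_iff₀ (Real.exp_pos _), mul_div_assoc, ← Real.exp_sub] at h2
  refine h2.trans_eq ?_
  rw [mul_assoc]
  congr 3
  field_simp
  ring

/-- Matrix Chernoff bound, lower tail, for sampling without replacement. -/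
theorem card_not_forall_le_sum_inner_sq [Nonempty α] (v : α → E) (I : Finset α) {R β : ℝ}
    (hR0 : 0 < R) (hR : ∀ a, ‖v a‖ ^ 2 ≤ R) (hβ : ∀ x, β * ‖x‖ ^ 2 ≤ ∑ a, ⟪v a, x⟫_ℝ ^ 2)
    (θ : ℝ) (B : Finset (Equiv.Perm α))
    (hB : ∀ σ ∈ B, ¬ ∀ x, θ * ‖x‖ ^ 2 ≤ ∑ i ∈ I, ⟪v (σ i), x⟫_ℝ ^ 2) :
    (B.card : ℝ) ≤ Fintype.card (Equiv.Perm α) * (finrank ℝ E *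
      Real.exp (-((9 / 11 * (I.card / Fintype.card α * β) - θ) / (10 * R)))) := by
  have h1 := exp_mul_card_le_traceSum v I (-(1 / (10 * R))) θ (B := B) fun σ hσ => by
    by_contra! hcon
    refine hB σ hσ fun x => ?_
    rw [← inner_frameOp_self, inner_apply_self_eq_sum (isSymmetric_frameOp v I σ)]
    have hx := ((isSymmetric_frameOp v I σ).eigenvectorBasis rfl).sum_sq_norm_inner_right x
    rw [← hx, Finset.mul_sum]
    refine Finset.sum_le_sum fun p _ => ?_
    rw [Real.norm_eq_abs, sq_abs]
    have hp := (hcon p).le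
    rw [neg_mul, neg_mul, neg_le_neg_iff] at hp
    have := le_of_mul_le_mul_left hp (by positivity)
    gcongr
  have h2 := h1.trans (traceSum_le_of_nonpos v I hR0 hR hβ)
  rw [← le_div_iff₀ (Real.exp_pos _), mul_div_assoc, ← Real.exp_sub] at h2
  refine h2.trans_eq ?_
  rw [mul_assoc]
  congr 3
  field_simp
  ring

end Concentration

/-! ### Singular values estimated through the adjoint. -/

section SingularValues

open InnerProductSpace Module

variable {E F : Type*} [NormedAddCommGroup E] [InnerProductSpace ℝ E] [FiniteDimensional ℝ E]
  [NormedAddCommGroup F] [InnerProductSpace ℝ F] [FiniteDimensional ℝ F]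

theorem norm_sq_eq_inner_adjoint_comp_self (T : E →ₗ[ℝ] F) (x : E) :
    ‖T x‖ ^ 2 = ⟪x, (T.adjoint ∘ₗ T) x⟫_ℝ := by
  rw [LinearMap.comp_apply, LinearMap.adjoint_inner_right, real_inner_self_eq_norm_sq]

/-- Courant–Fischer: a lower bound for `T` on a subspace of dimension more than `i` bounds the
singular value of index `i` from below. -/
theorem le_singularValues_of_forall_mem (T : E →ₗ[ℝ] F) (W : Submodule ℝ E) {γ : ℝ}
    (hW : ∀ x ∈ W, γ * ‖x‖ ≤ ‖T x‖) {i : ℕ} (hi : i < finrank ℝ W) :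
    γ ≤ T.singularValues i := by
  have hid : i < finrank ℝ E := hi.trans_le W.finrank_le
  set hS := T.isSymmetric_adjoint_comp_self
  let b := hS.eigenvectorBasis rfl
  -- Some nonzero vector of W is orthogonal to the first i eigenvectors, by dimension count; on it T
  -- stretches by at most the singular value of index i, counted from 0.
  let φ : W →ₗ[ℝ] (Fin i → ℝ) := LinearMap.pi fun q =>
    ((innerSL ℝ (b ⟨q, q.2.trans hid⟩)).toLinearMap).comp W.subtype
  have hker : φ.ker ≠ ⊥ := LinearMap.ker_ne_bot_of_finrank_lt (by simpa using hi)
  obtain ⟨x, hx, hx0⟩ := Submodule.exists_mem_ne_zero_of_ne_bot hker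
  have hxq : ∀ p : Fin (finrank ℝ E), (p : ℕ) < i → ⟪b p, (x : E)⟫_ℝ = 0 := fun p hp =>
    congrFun (LinearMap.mem_ker.1 hx) ⟨p, hp⟩
  have hle : ‖T x‖ ^ 2 ≤ (T.singularValues i * ‖(x : E)‖) ^ 2 := by
    rw [norm_sq_eq_inner_adjoint_comp_self, inner_apply_self_eq_sum hS, mul_pow,
      ← b.sum_sq_norm_inner_right, Finset.mul_sum]
    refine Finset.sum_le_sum fun p _ => ?_
    rw [Real.norm_eq_abs, sq_abs]
    by_cases hp : (p : ℕ) < i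
    · have := hxq p hp
      simp only [b] at this
      simp [b, this]
    · rw [← T.sq_singularValues_fin rfl p]
      have h1 := T.singularValues_antitone (not_lt.1 hp)
      have h2 := T.singularValues_nonneg p
      gcongr
  have h1 := abs_le_of_sq_le_sq hle
    (mul_nonneg (T.singularValues_nonneg i) (norm_nonneg _))
  have h2 := (hW x x.2).trans ((le_abs_self _).trans h1)
  exact le_of_mul_le_mul_right h2 (norm_pos_iff.2 (by simpa using hx0))

theorem singularValues_le_of_forall (T : E →ₗ[ℝ] F) {γ : ℝ} (hγ : 0 ≤ γ)
    (hT : ∀ x, ‖T x‖ ≤ γ * ‖x‖) (i : ℕ) : T.singularValues i ≤ γ := by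
  by_cases hi : i < finrank ℝ E
  · obtain ⟨x, hx⟩ := (T.hasEigenvalue_adjoint_comp_self_sq_singularValues hi).exists_hasEigenvector
    have h1 := norm_sq_eq_inner_adjoint_comp_self T x
    rw [hx.apply_eq_smul, inner_smul_right, real_inner_self_eq_norm_sq, ← mul_pow] at h1
    have h2 := hT x
    rw [(pow_left_inj₀ (norm_nonneg _)
      (mul_nonneg (T.singularValues_nonneg i) (norm_nonneg _)) two_ne_zero).1 h1] at h2
    exact le_of_mul_le_mul_right h2 (norm_pos_iff.2 hx.2)
  · rw [T.singularValues_of_finrank_le (not_lt.1 hi)]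
    exact hγ

theorem singularValues_le_sqrt_of_adjoint (T : E →ₗ[ℝ] F) {θ : ℝ} (hθ : 0 ≤ θ)
    (hT : ∀ y, ‖T.adjoint y‖ ^ 2 ≤ θ * ‖y‖ ^ 2) (i : ℕ) : T.singularValues i ≤ √θ := by
  refine singularValues_le_of_forall T (Real.sqrt_nonneg θ) (fun x => ?_) i
  rcases (norm_nonneg (T x)).eq_or_lt with h0 | h0
  · rw [← h0]; positivity
  have h1 : ‖T.adjoint (T x)‖ ≤ √θ * ‖T x‖ := by
    refine le_of_sq_le_sq ?_ (by positivity)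
    rw [mul_pow, Real.sq_sqrt hθ]
    exact hT _
  have h2 : ‖T x‖ * ‖T x‖ ≤ ‖x‖ * ‖T.adjoint (T x)‖ := by
    rw [← sq, norm_sq_eq_inner_adjoint_comp_self]
    exact real_inner_le_norm _ _
  have h3 := h2.trans (mul_le_mul_of_nonneg_left h1 (norm_nonneg x))
  exact le_of_mul_le_mul_right (by linarith) h0

/-- The test space for Courant–Fischer is the range of T*J, of the same dimension as K by
injectivity. There T is bounded below because ‖T*Jy‖² = ⟨Jy, TT*Jy⟩ ≤ ‖TT*Jy‖‖y‖. -/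
theorem sqrt_le_singularValues_of_adjoint {K : Type*} [NormedAddCommGroup K]
    [InnerProductSpace ℝ K] [FiniteDimensional ℝ K] (T : E →ₗ[ℝ] F) (J : K →ₗ[ℝ] F)
    (hJ : ∀ y, ‖J y‖ = ‖y‖) {θ : ℝ} (hθ : 0 < θ)
    (hT : ∀ y, θ * ‖y‖ ^ 2 ≤ ‖T.adjoint (J y)‖ ^ 2) {i : ℕ} (hi : i < finrank ℝ K) :
    √θ ≤ T.singularValues i := by
  have hT' : ∀ y, √θ * ‖y‖ ≤ ‖T.adjoint (J y)‖ := by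
    intro y
    refine le_of_sq_le_sq ?_ (norm_nonneg _)
    rw [mul_pow, Real.sq_sqrt hθ.le]
    exact hT y
  have hinj : Function.Injective (T.adjoint ∘ₗ J) := by
    rw [injective_iff_map_eq_zero]
    intro y hy
    have h1 := hT' y
    rw [← LinearMap.comp_apply, hy, norm_zero] at h1
    have h2 : 0 < √θ := Real.sqrt_pos.2 hθ
    exact norm_le_zero_iff.1 (by nlinarith)
  refine le_singularValues_of_forall_mem T (LinearMap.range (T.adjoint ∘ₗ J)) ?_
    (by rwa [LinearMap.finrank_range_of_inj hinj])
  rintro _ ⟨y, rfl⟩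
  rcases (norm_nonneg y).eq_or_lt with h0 | h0
  · rw [norm_eq_zero.1 h0.symm]; simp
  rw [LinearMap.comp_apply]
  have h1 : ‖T.adjoint (J y)‖ ^ 2 ≤ ‖T (T.adjoint (J y))‖ * ‖y‖ := by
    rw [← real_inner_self_eq_norm_sq, LinearMap.adjoint_inner_right, ← hJ y]
    exact real_inner_le_norm _ _
  have h2 := mul_le_mul_of_nonneg_right (hT' y) (norm_nonneg (T.adjoint (J y)))
  exact le_of_mul_le_mul_right (by nlinarith) h0

end SingularValues

/-! ### Columns, projections and the singular value decomposition. -/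

section Matrices

open InnerProductSpace

variable {m n ℓ k : ℕ}

theorem norm_sq_toEuclideanLin (A : Matrix (Fin m) (Fin n) ℝ) (x : EuclideanSpace ℝ (Fin n)) :
    ‖Matrix.toEuclideanLin A x‖ ^ 2 = ∑ i, (A *ᵥ x.ofLp) i ^ 2 := by
  rw [EuclideanSpace.real_norm_sq_eq]; rfl

/-- The `a`-th column of `A` as a vector of the Euclidean space. -/
noncomputable def colVec (A : Matrix (Fin m) (Fin n) ℝ) (a : Fin n) : EuclideanSpace ℝ (Fin m) :=
  WithLp.toLp 2 (Aᵀ a)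

theorem inner_colVec (A : Matrix (Fin m) (Fin n) ℝ) (a : Fin n) (x : EuclideanSpace ℝ (Fin m)) :
    ⟪colVec A a, x⟫_ℝ = (Aᵀ *ᵥ x.ofLp) a := by
  simp [colVec, PiLp.inner_apply, Matrix.mulVec, dotProduct, mul_comm]

theorem sum_inner_colVec_sq (A : Matrix (Fin m) (Fin n) ℝ) (x : EuclideanSpace ℝ (Fin m)) :
    ∑ a, ⟪colVec A a, x⟫_ℝ ^ 2 = ‖Matrix.toEuclideanLin Aᵀ x‖ ^ 2 := by
  simp_rw [norm_sq_toEuclideanLin, inner_colVec]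

theorem sum_inner_colVec_batch_sq (A : Matrix (Fin m) (Fin n) ℝ) (h : ℓ ≤ n)
    (σ : Equiv.Perm (Fin n)) (x : EuclideanSpace ℝ (Fin m)) :
    ∑ i ∈ Finset.univ.map (Fin.castLEEmb h), ⟪colVec A (σ i), x⟫_ℝ ^ 2 =
      ‖Matrix.toEuclideanLin (batch A h σ)ᵀ x‖ ^ 2 := by
  simp_rw [Finset.sum_map, norm_sq_toEuclideanLin, inner_colVec]
  rfl

theorem mul_batch (C : Matrix (Fin k) (Fin m) ℝ) (A : Matrix (Fin m) (Fin n) ℝ) (h : ℓ ≤ n)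
    (σ : Equiv.Perm (Fin n)) : C * batch A h σ = batch (C * A) h σ := rfl

theorem adjoint_toEuclideanLin (A : Matrix (Fin m) (Fin n) ℝ) :
    (Matrix.toEuclideanLin A).adjoint = Matrix.toEuclideanLin Aᵀ := by
  rw [← Matrix.toEuclideanLin_conjTranspose_eq_adjoint, Matrix.conjTranspose_eq_transpose_of_trivial]

theorem firstCols_transpose_mul_self {U : Matrix (Fin m) (Fin m) ℝ}
    (hU : U ∈ Matrix.orthogonalGroup (Fin m) ℝ) (h : k ≤ m) :
    (firstCols U h)ᵀ * firstCols U h = 1 := by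
  have h1 : Uᵀ * U = 1 := (Matrix.mem_orthogonalGroup_iff' (Fin m) ℝ).1 hU
  have : (firstCols U h)ᵀ * firstCols U h =
      (Uᵀ * U).submatrix (Fin.castLE h) (Fin.castLE h) := rfl
  rw [this, h1, Matrix.submatrix_one _ (Fin.castLE_injective h)]

theorem topProj_transpose (U : Matrix (Fin m) (Fin m) ℝ) (h : k ≤ m) :
    (topProj U h)ᵀ = topProj U h := by
  simp [topProj, Matrix.transpose_mul]

theorem norm_toEuclideanLin_of_transpose_mul_self {A : Matrix (Fin m) (Fin n) ℝ} (hA : Aᵀ * A = 1)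
    (x : EuclideanSpace ℝ (Fin n)) : ‖Matrix.toEuclideanLin A x‖ = ‖x‖ := by
  have h : ‖Matrix.toEuclideanLin A x‖ ^ 2 = ‖x‖ ^ 2 := by
    rw [norm_sq_eq_inner_adjoint_comp_self, adjoint_toEuclideanLin, LinearMap.comp_apply,
      ← real_inner_self_eq_norm_sq]
    simp only [Matrix.toLpLin_apply, Matrix.mulVec_mulVec, hA, Matrix.one_mulVec]
  exact (pow_left_inj₀ (norm_nonneg _) (norm_nonneg _) two_ne_zero).1 h

theorem sv_nonneg (A : Matrix (Fin m) (Fin n) ℝ) (i : ℕ) : 0 ≤ sv A i :=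
  LinearMap.singularValues_nonneg _ _

theorem sv_anti (A : Matrix (Fin m) (Fin n) ℝ) {i j : ℕ} (h : i ≤ j) : sv A j ≤ sv A i :=
  LinearMap.singularValues_antitone _ (by omega)

theorem sv_le_sqrt {A : Matrix (Fin m) (Fin n) ℝ} {θ : ℝ} (hθ : 0 ≤ θ)
    (h : ∀ x, ‖Matrix.toEuclideanLin Aᵀ x‖ ^ 2 ≤ θ * ‖x‖ ^ 2) (i : ℕ) : sv A i ≤ √θ := by
  refine singularValues_le_sqrt_of_adjoint _ hθ (fun y => ?_) _
  rw [adjoint_toEuclideanLin]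
  exact h y

/-- The projected matrix has rank at most k, so a lower bound cannot hold on all of ℝᵐ in general.
It is assumed on ℝᵏ instead and transported by the isometry U_{1:k}. -/
theorem sqrt_le_sv_topProj_mul {U : Matrix (Fin m) (Fin m) ℝ}
    (hU : U ∈ Matrix.orthogonalGroup (Fin m) ℝ) (h : k ≤ m) (hk : 1 ≤ k)
    {A : Matrix (Fin m) (Fin n) ℝ} {θ : ℝ} (hθ : 0 < θ)
    (hA : ∀ y, θ * ‖y‖ ^ 2 ≤ ‖Matrix.toEuclideanLin ((firstCols U h)ᵀ * A)ᵀ y‖ ^ 2) :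
    √θ ≤ sv (topProj U h * A) k := by
  have hUU := firstCols_transpose_mul_self hU h
  refine sqrt_le_singularValues_of_adjoint _ (Matrix.toEuclideanLin (firstCols U h))
    (norm_toEuclideanLin_of_transpose_mul_self hUU) hθ (fun y => ?_) (by simp; omega)
  refine (hA y).trans_eq ?_
  rw [adjoint_toEuclideanLin]
  simp only [Matrix.toLpLin_apply, Matrix.mulVec_mulVec]
  rw [Matrix.transpose_mul _ A, Matrix.transpose_mul _ A, topProj_transpose,
    Matrix.transpose_transpose, topProj, Matrix.mul_assoc, Matrix.mul_assoc, hUU, Matrix.mul_one]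

theorem topProj_eq_mul_diagonal_mul (U : Matrix (Fin m) (Fin m) ℝ) (h : k ≤ m) :
    topProj U h = U * Matrix.diagonal (fun r : Fin m => if (r : ℕ) < k then 1 else 0) * Uᵀ := by
  ext i j
  rw [topProj, Matrix.mul_apply, Matrix.mul_apply]
  simp only [Matrix.mul_diagonal, Matrix.transpose_apply, mul_ite, mul_one, mul_zero, ite_mul,
    zero_mul]
  rw [← Finset.sum_filter]
  have : Finset.univ.filter (fun r : Fin m => (r : ℕ) < k) =
      Finset.univ.map (Fin.castLEEmb h) := by
    ext r
    simp only [Finset.mem_filter, Finset.mem_univ, true_and, Finset.mem_map, Fin.castLEEmb_apply]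
    exact ⟨fun hr => ⟨⟨r, hr⟩, rfl⟩, fun ⟨a, ha⟩ => ha ▸ a.2⟩
  rw [this, Finset.sum_map]
  rfl

theorem one_sub_topProj_eq {U : Matrix (Fin m) (Fin m) ℝ}
    (hU : U ∈ Matrix.orthogonalGroup (Fin m) ℝ) (h : k ≤ m) :
    1 - topProj U h =
      U * Matrix.diagonal (fun r : Fin m => if (r : ℕ) < k then 0 else 1) * Uᵀ := by
  have h1 : U * Uᵀ = 1 := (Matrix.mem_orthogonalGroup_iff (Fin m) ℝ).1 hU
  have h2 : Matrix.diagonal (fun r : Fin m => if (r : ℕ) < k then (0 : ℝ) else 1) =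
      1 - Matrix.diagonal (fun r : Fin m => if (r : ℕ) < k then 1 else 0) := by
    rw [← Matrix.diagonal_one, Matrix.diagonal_sub]
    congr 1
    ext r
    split_ifs <;> simp
  rw [h2, topProj_eq_mul_diagonal_mul, Matrix.mul_sub, Matrix.sub_mul, Matrix.mul_one, h1]

/-- The source of the radius R = m in both Chernoff bounds; neither projection increases it. -/
theorem norm_sq_colVec_le {A : Matrix (Fin m) (Fin n) ℝ} (hA : ∀ i j, A i j ∈ Set.Icc (0 : ℝ) 1)
    (a : Fin n) : ‖colVec A a‖ ^ 2 ≤ m := by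
  rw [EuclideanSpace.real_norm_sq_eq]
  calc _ ≤ ∑ _i : Fin m, (1 : ℝ) := Finset.sum_le_sum fun i _ =>
        pow_le_one₀ (hA i a).1 (hA i a).2
    _ = m := by simp

theorem colVec_mul (C : Matrix (Fin k) (Fin m) ℝ) (A : Matrix (Fin m) (Fin n) ℝ) (a : Fin n) :
    colVec (C * A) a = Matrix.toEuclideanLin C (colVec A a) := rfl

theorem norm_toEuclideanLin_transpose {U : Matrix (Fin m) (Fin m) ℝ}
    (hU : U ∈ Matrix.orthogonalGroup (Fin m) ℝ) (x : EuclideanSpace ℝ (Fin m)) :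
    ‖Matrix.toEuclideanLin Uᵀ x‖ = ‖x‖ :=
  norm_toEuclideanLin_of_transpose_mul_self
    (by rw [Matrix.transpose_transpose]; exact (Matrix.mem_orthogonalGroup_iff (Fin m) ℝ).1 hU) x

theorem norm_sq_firstCols_transpose_le {U : Matrix (Fin m) (Fin m) ℝ}
    (hU : U ∈ Matrix.orthogonalGroup (Fin m) ℝ) (h : k ≤ m) (x : EuclideanSpace ℝ (Fin m)) :
    ‖Matrix.toEuclideanLin (firstCols U h)ᵀ x‖ ^ 2 ≤ ‖x‖ ^ 2 := by
  rw [← norm_toEuclideanLin_transpose hU x, norm_sq_toEuclideanLin, norm_sq_toEuclideanLin]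
  have : ∑ i, ((firstCols U h)ᵀ *ᵥ x.ofLp) i ^ 2 =
      ∑ r ∈ Finset.univ.map (Fin.castLEEmb h), (Uᵀ *ᵥ x.ofLp) r ^ 2 := by
    rw [Finset.sum_map]; rfl
  rw [this]
  exact Finset.sum_le_univ_sum_of_nonneg fun r => sq_nonneg _

theorem transpose_mulVec_one_sub_topProj {U : Matrix (Fin m) (Fin m) ℝ}
    (hU : U ∈ Matrix.orthogonalGroup (Fin m) ℝ) (h : k ≤ m) (x : Fin m → ℝ) (r : Fin m) :
    (Uᵀ *ᵥ ((1 - topProj U h) *ᵥ x)) r = if (r : ℕ) < k then 0 else (Uᵀ *ᵥ x) r := by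
  have h1 : Uᵀ * U = 1 := (Matrix.mem_orthogonalGroup_iff' (Fin m) ℝ).1 hU
  rw [one_sub_topProj_eq hU h, Matrix.mulVec_mulVec, ← Matrix.mul_assoc, ← Matrix.mul_assoc, h1,
    Matrix.one_mul, ← Matrix.mulVec_mulVec, Matrix.mulVec_diagonal]
  simp

theorem norm_sq_one_sub_topProj_le {U : Matrix (Fin m) (Fin m) ℝ}
    (hU : U ∈ Matrix.orthogonalGroup (Fin m) ℝ) (h : k ≤ m) (x : EuclideanSpace ℝ (Fin m)) :
    ‖Matrix.toEuclideanLin (1 - topProj U h) x‖ ^ 2 ≤ ‖x‖ ^ 2 := by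
  rw [← norm_toEuclideanLin_transpose hU x,
    ← norm_toEuclideanLin_transpose hU (Matrix.toEuclideanLin (1 - topProj U h) x),
    norm_sq_toEuclideanLin, norm_sq_toEuclideanLin]
  refine Finset.sum_le_sum fun r _ => ?_
  rw [Matrix.ofLp_toLpLin, Matrix.toLin'_apply, transpose_mulVec_one_sub_topProj hU h]
  split_ifs
  · rw [zero_pow two_ne_zero]
    exact sq_nonneg _
  · rfl

/-- V cancels, so squared norms of Mᵀx become weighted sums of squares in the coordinates Uᵀx. Rows
beyond the n-th carry no singular value and get weight 0. -/
theorem IsSVD.mul_transpose {M : Matrix (Fin m) (Fin n) ℝ} {U : Matrix (Fin m) (Fin m) ℝ}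
    {V : Matrix (Fin n) (Fin n) ℝ} (h : IsSVD M U V) :
    M * Mᵀ = U * Matrix.diagonal
      (fun r : Fin m => if (r : ℕ) < n then sv M (r + 1) ^ 2 else 0) * Uᵀ := by
  obtain ⟨hU, hV, hM⟩ := h
  set S : Matrix (Fin m) (Fin n) ℝ := Matrix.of fun (i : Fin m) (j : Fin n) =>
    if (i : ℕ) = (j : ℕ) then sv M ((i : ℕ) + 1) else 0 with hS
  have hSS : S * Sᵀ = Matrix.diagonal
      (fun r : Fin m => if (r : ℕ) < n then sv M (r + 1) ^ 2 else 0) := by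
    ext r r'
    rw [Matrix.mul_apply, Matrix.diagonal_apply]
    simp only [hS, Matrix.of_apply, Matrix.transpose_apply]
    by_cases hr : (r : ℕ) < n
    · rw [Finset.sum_eq_single ⟨r, hr⟩]
      · by_cases hrr : r = r'
        · simp [hrr, sq, hrr ▸ hr]
        · have : (r' : ℕ) ≠ r := fun h => hrr (Fin.ext h.symm)
          simp [hrr, this]
      · intro j _ hj
        have : (r : ℕ) ≠ j := fun h => hj (Fin.ext h.symm)
        simp [this]
      · simp
    · rw [Finset.sum_eq_zero]
      · simp [hr]
      · intro j _
        have : (r : ℕ) ≠ j := fun h => hr (h ▸ j.2)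
        simp [this]
  have hVV : Vᵀ * V = 1 := (Matrix.mem_orthogonalGroup_iff' (Fin n) ℝ).1 hV
  calc M * Mᵀ = (U * S * Vᵀ) * (U * S * Vᵀ)ᵀ := by rw [← hM]
    _ = U * S * (Vᵀ * V) * Sᵀ * Uᵀ := by
      simp only [Matrix.transpose_mul, Matrix.transpose_transpose, Matrix.mul_assoc]
    _ = _ := by rw [hVV, Matrix.mul_one, Matrix.mul_assoc U, hSS]

theorem IsSVD.norm_sq_transpose {M : Matrix (Fin m) (Fin n) ℝ} {U : Matrix (Fin m) (Fin m) ℝ}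
    {V : Matrix (Fin n) (Fin n) ℝ} (h : IsSVD M U V) (x : EuclideanSpace ℝ (Fin m)) :
    ‖Matrix.toEuclideanLin Mᵀ x‖ ^ 2 =
      ∑ r : Fin m, (if (r : ℕ) < n then sv M (r + 1) ^ 2 else 0) * (Uᵀ *ᵥ x.ofLp) r ^ 2 := by
  rw [norm_sq_toEuclideanLin]
  have h1 : ∑ i, (Mᵀ *ᵥ x.ofLp) i ^ 2 = x.ofLp ⬝ᵥ ((M * Mᵀ) *ᵥ x.ofLp) := by
    rw [← Matrix.mulVec_mulVec, Matrix.dotProduct_mulVec, ← Matrix.mulVec_transpose]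
    simp [dotProduct, sq]
  rw [h1, h.mul_transpose, ← Matrix.mulVec_mulVec, ← Matrix.mulVec_mulVec,
    Matrix.dotProduct_mulVec, ← Matrix.mulVec_transpose]
  simp only [dotProduct, Matrix.mulVec_diagonal]
  exact Finset.sum_congr rfl fun r _ => by ring

/-- In the coordinates Uᵀx the projection 1 - P removes the first k, and each remaining weight is at
most s_{k+1}². -/
theorem IsSVD.norm_sq_one_sub_topProj_mul_transpose_le {M : Matrix (Fin m) (Fin n) ℝ}
    {U : Matrix (Fin m) (Fin m) ℝ} {V : Matrix (Fin n) (Fin n) ℝ} (hM : IsSVD M U V) (h : k ≤ m)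
    (x : EuclideanSpace ℝ (Fin m)) :
    ‖Matrix.toEuclideanLin ((1 - topProj U h) * M)ᵀ x‖ ^ 2 ≤ sv M (k + 1) ^ 2 * ‖x‖ ^ 2 := by
  have h1 : Matrix.toEuclideanLin ((1 - topProj U h) * M)ᵀ x =
      Matrix.toEuclideanLin Mᵀ (Matrix.toEuclideanLin (1 - topProj U h) x) := by
    simp only [Matrix.toLpLin_apply, Matrix.mulVec_mulVec]
    rw [Matrix.transpose_mul, Matrix.transpose_sub, topProj_transpose, Matrix.transpose_one]
  rw [h1, hM.norm_sq_transpose, ← norm_toEuclideanLin_transpose hM.1 x, norm_sq_toEuclideanLin,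
    Finset.mul_sum]
  refine Finset.sum_le_sum fun r _ => ?_
  rw [Matrix.ofLp_toLpLin, Matrix.toLin'_apply, transpose_mulVec_one_sub_topProj hM.1 h]
  by_cases hr : (r : ℕ) < k
  · simp only [hr, if_true]
    have := sq_nonneg (sv M (k + 1) * (Uᵀ *ᵥ x.ofLp) r)
    nlinarith
  · simp only [hr, if_false]
    gcongr
    split_ifs
    · have := sv_anti M (show k + 1 ≤ r + 1 by omega)
      have := sv_nonneg M (r + 1)
      gcongr
    · positivity

theorem IsSVD.le_norm_sq_firstCols_transpose_mul_transpose {M : Matrix (Fin m) (Fin n) ℝ}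
    {U : Matrix (Fin m) (Fin m) ℝ} {V : Matrix (Fin n) (Fin n) ℝ} (hM : IsSVD M U V) (h : k ≤ m)
    (hn : k ≤ n) (y : EuclideanSpace ℝ (Fin k)) :
    sv M k ^ 2 * ‖y‖ ^ 2 ≤ ‖Matrix.toEuclideanLin ((firstCols U h)ᵀ * M)ᵀ y‖ ^ 2 := by
  have hUU : Uᵀ * U = 1 := (Matrix.mem_orthogonalGroup_iff' (Fin m) ℝ).1 hM.1
  have h1 : Matrix.toEuclideanLin ((firstCols U h)ᵀ * M)ᵀ y =
      Matrix.toEuclideanLin Mᵀ (Matrix.toEuclideanLin (firstCols U h) y) := by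
    simp only [Matrix.toLpLin_apply, Matrix.mulVec_mulVec]
    rw [Matrix.transpose_mul, Matrix.transpose_transpose]
  rw [h1, hM.norm_sq_transpose, EuclideanSpace.real_norm_sq_eq, Finset.mul_sum]
  refine le_trans ?_ (Finset.sum_le_univ_sum_of_nonneg
    (s := Finset.univ.map (Fin.castLEEmb h)) fun r => ?_)
  · rw [Finset.sum_map]
    refine Finset.sum_le_sum fun a _ => ?_
    have h2 : (Uᵀ *ᵥ (Matrix.toEuclideanLin (firstCols U h) y).ofLp) (Fin.castLEEmb h a) =
        y.ofLp a := by
      have h3 : Uᵀ * firstCols U h = (Uᵀ * U).submatrix id (Fin.castLE h) := rfl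
      rw [Matrix.ofLp_toLpLin, Matrix.toLin'_apply, Matrix.mulVec_mulVec, h3, hUU]
      simp only [Matrix.mulVec, dotProduct, Matrix.submatrix_apply, id_eq, Fin.castLEEmb_apply,
        Matrix.one_apply, (Fin.castLE_injective h).eq_iff]
      simp
    rw [h2]
    have ha : ((Fin.castLEEmb h a : Fin m) : ℕ) = a := rfl
    have han : (a : ℕ) < n := a.2.trans_le hn
    rw [ha, if_pos han]
    have := sv_anti M (show (a : ℕ) + 1 ≤ k from a.2)
    have := sv_nonneg M k
    gcongr
  · split_ifs <;> positivity

end Matrices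

/-! ### Tail bounds for a random batch and the non-asymptotic theorem. -/

section Sampling

variable {m n ℓ k : ℕ}

theorem arrivalProb_le_one (S : Set (Equiv.Perm (Fin n))) : arrivalProb S ≤ 1 :=
  ((PMF.uniformOfFintype _).toOuterMeasure.mono (Set.subset_univ S)).trans_eq
    ((PMF.toOuterMeasure_apply_eq_one_iff _ _).2 (Set.subset_univ _))

theorem one_sub_le_arrivalProb (S : Set (Equiv.Perm (Fin n))) {δ : ℝ}
    (B : Finset (Equiv.Perm (Fin n))) (hB : ∀ σ, σ ∉ B → σ ∈ S)
    (hδ : (B.card : ℝ) ≤ Fintype.card (Equiv.Perm (Fin n)) * δ) :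
    1 - ENNReal.ofReal δ ≤ arrivalProb S := by
  classical
  have hN : (0 : ℝ) < Fintype.card (Equiv.Perm (Fin n)) := by exact_mod_cast Fintype.card_pos
  rw [arrivalProb, PMF.toOuterMeasure_uniformOfFintype_apply, tsub_le_iff_right]
  have h1 : Fintype.card (Equiv.Perm (Fin n)) ≤ Fintype.card S + B.card := by
    rw [← Set.toFinset_card, ← Finset.card_univ]
    refine (Finset.card_le_card fun σ _ => ?_).trans (Finset.card_union_le _ _)
    by_cases h : σ ∈ B
    · exact Finset.mem_union_right _ h
    · exact Finset.mem_union_left _ (Set.mem_toFinset.2 (hB σ h))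
  have h2 : (B.card : ℝ≥0∞) / Fintype.card (Equiv.Perm (Fin n)) ≤ ENNReal.ofReal δ := by
    refine ENNReal.div_le_of_le_mul ?_
    rw [← ENNReal.ofReal_natCast, ← ENNReal.ofReal_natCast (Fintype.card (Equiv.Perm (Fin n))),
      ← ENNReal.ofReal_mul' hN.le, mul_comm δ]
    exact ENNReal.ofReal_le_ofReal hδ
  refine le_trans ?_ (add_le_add_right h2 _)
  rw [ENNReal.div_add_div_same, ENNReal.le_div_iff_mul_le (by simp) (by simp), one_mul]
  exact_mod_cast h1

/-- Upper tail for the norm of a random batch of columns. -/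
theorem card_not_forall_norm_batch_sq_le (A : Matrix (Fin m) (Fin n) ℝ) (hn : 0 < n) (hℓn : ℓ ≤ n)
    {R β : ℝ} (hR0 : 0 < R) (hR : ∀ a, ‖colVec A a‖ ^ 2 ≤ R)
    (hβ : ∀ x, ‖Matrix.toEuclideanLin Aᵀ x‖ ^ 2 ≤ β * ‖x‖ ^ 2) (θ : ℝ)
    (B : Finset (Equiv.Perm (Fin n)))
    (hB : ∀ σ ∈ B, ¬ ∀ x, ‖Matrix.toEuclideanLin (batch A hℓn σ)ᵀ x‖ ^ 2 ≤ θ * ‖x‖ ^ 2) :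
    (B.card : ℝ) ≤ Fintype.card (Equiv.Perm (Fin n)) *
      (m * Real.exp (-((θ - 3 * (ℓ / n * β)) / (2 * R)))) := by
  have : Nonempty (Fin n) := ⟨⟨0, hn⟩⟩
  have h := card_not_forall_sum_inner_sq_le (colVec A) (Finset.univ.map (Fin.castLEEmb hℓn)) hR0 hR
    (β := β) (by simpa only [sum_inner_colVec_sq] using hβ) θ B
    (by simpa only [sum_inner_colVec_batch_sq] using hB)
  rwa [finrank_euclideanSpace_fin, Finset.card_map, Finset.card_univ, Fintype.card_fin,
    Fintype.card_fin] at h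

/-- Lower tail for the norm of a random batch of columns. -/
theorem card_not_forall_le_norm_batch_sq (A : Matrix (Fin m) (Fin n) ℝ) (hn : 0 < n) (hℓn : ℓ ≤ n)
    {R β : ℝ} (hR0 : 0 < R) (hR : ∀ a, ‖colVec A a‖ ^ 2 ≤ R)
    (hβ : ∀ x, β * ‖x‖ ^ 2 ≤ ‖Matrix.toEuclideanLin Aᵀ x‖ ^ 2) (θ : ℝ)
    (B : Finset (Equiv.Perm (Fin n)))
    (hB : ∀ σ ∈ B, ¬ ∀ x, θ * ‖x‖ ^ 2 ≤ ‖Matrix.toEuclideanLin (batch A hℓn σ)ᵀ x‖ ^ 2) :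
    (B.card : ℝ) ≤ Fintype.card (Equiv.Perm (Fin n)) *
      (m * Real.exp (-((9 / 11 * (ℓ / n * β) - θ) / (10 * R)))) := by
  have : Nonempty (Fin n) := ⟨⟨0, hn⟩⟩
  have h := card_not_forall_le_sum_inner_sq (colVec A) (Finset.univ.map (Fin.castLEEmb hℓn)) hR0 hR
    (β := β) (by simpa only [sum_inner_colVec_sq] using hβ) θ B
    (by simpa only [sum_inner_colVec_batch_sq] using hB)
  rwa [finrank_euclideanSpace_fin, Finset.card_map, Finset.card_univ, Fintype.card_fin,
    Fintype.card_fin] at h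

theorem ofReal_sqrt_le_extRatio {x y μ ε : ℝ} (hμ : 0 < μ) (hε : 0 < ε) (hx : √(μ / 2) ≤ x)
    (hy : y ≤ √(ε * μ)) : ENNReal.ofReal (√(1 / (2 * ε))) ≤ extRatio x y :=
  calc ENNReal.ofReal (√(1 / (2 * ε)))
      = ENNReal.ofReal (√(μ / 2) / √(ε * μ)) := by
        rw [← Real.sqrt_div (by positivity)]
        congr 2
        field_simp
    _ = ENNReal.ofReal (√(μ / 2)) / ENNReal.ofReal (√(ε * μ)) :=
        ENNReal.ofReal_div_of_pos (Real.sqrt_pos.2 (by positivity))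
    _ ≤ _ := ENNReal.div_le_div (ENNReal.ofReal_le_ofReal hx) (ENNReal.ofReal_le_ofReal hy)

/-- Non-asymptotic form of the main theorem. -/
theorem IsSVD.one_sub_le_arrivalProb {M : Matrix (Fin m) (Fin n) ℝ}
    {U : Matrix (Fin m) (Fin m) ℝ} {V : Matrix (Fin n) (Fin n) ℝ} (hsvd : IsSVD M U V)
    (hM : ∀ i j, M i j ∈ Set.Icc (0 : ℝ) 1) (hℓ : 1 ≤ ℓ) (hℓn : ℓ ≤ n) (hk : 1 ≤ k)
    (hkm : k ≤ m) (hkn : k ≤ n) (hs : 0 < sv M k) {ε : ℝ} (hε : 0 < ε)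
    (hgap : 6 * sv M (k + 1) ^ 2 ≤ ε * sv M k ^ 2) :
    1 - ENNReal.ofReal (m * Real.exp (-((ℓ / n * sv M k ^ 2) / (40 * m))) +
        m * Real.exp (-((ε * (ℓ / n * sv M k ^ 2)) / (4 * m)))) ≤
      arrivalProb {σ : Equiv.Perm (Fin n) |
        Real.sqrt ((ℓ : ℝ) / (2 * (n : ℝ))) * sv M k
            ≤ sv (topProj U hkm * batch M hℓn σ) k ∧
        ENNReal.ofReal (√(1 / (2 * ε)))
            ≤ extRatio (sv (topProj U hkm * batch M hℓn σ) k)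
                (sv ((1 - topProj U hkm) * batch M hℓn σ) 1)} := by
  classical
  set μ : ℝ := ℓ / n * sv M k ^ 2 with hμ
  have hm0 : (0 : ℝ) < m := by exact_mod_cast hk.trans hkm
  have hn0 : (0 : ℝ) < n := by exact_mod_cast hk.trans hkn
  have hℓ0 : (0 : ℝ) < ℓ := by exact_mod_cast hℓ
  have hμ0 : 0 < μ := by positivity
  obtain ⟨lowerBad, hlb⟩ : ∃ B : Finset (Equiv.Perm (Fin n)), ∀ σ, σ ∈ B ↔
      ¬ ∀ x, μ / 2 * ‖x‖ ^ 2 ≤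
        ‖Matrix.toEuclideanLin (batch ((firstCols U hkm)ᵀ * M) hℓn σ)ᵀ x‖ ^ 2 :=
    ⟨(Set.toFinite {σ | _}).toFinset, fun σ => Set.Finite.mem_toFinset _⟩
  obtain ⟨upperBad, hub⟩ : ∃ B : Finset (Equiv.Perm (Fin n)), ∀ σ, σ ∈ B ↔
      ¬ ∀ x, ‖Matrix.toEuclideanLin (batch ((1 - topProj U hkm) * M) hℓn σ)ᵀ x‖ ^ 2 ≤
        ε * μ * ‖x‖ ^ 2 :=
    ⟨(Set.toFinite {σ | _}).toFinset, fun σ => Set.Finite.mem_toFinset _⟩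
  -- The lower tail is applied to vectors in ℝᵏ, where the full sum is bounded below by s_k².
  have hlower := card_not_forall_le_norm_batch_sq ((firstCols U hkm)ᵀ * M) (hk.trans hkn) hℓn
    (R := m) (β := sv M k ^ 2) hm0
    (fun a => by
      rw [colVec_mul]
      exact (norm_sq_firstCols_transpose_le hsvd.1 hkm _).trans (norm_sq_colVec_le hM a))
    (hsvd.le_norm_sq_firstCols_transpose_mul_transpose hkm hkn)
    (μ / 2) lowerBad (fun σ => (hlb σ).1)
  have hupper := card_not_forall_norm_batch_sq_le ((1 - topProj U hkm) * M) (hk.trans hkn) hℓn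
    (R := m) (β := sv M (k + 1) ^ 2) hm0
    (fun a => by
      rw [colVec_mul]
      exact (norm_sq_one_sub_topProj_le hsvd.1 hkm _).trans (norm_sq_colVec_le hM a))
    (hsvd.norm_sq_one_sub_topProj_mul_transpose_le hkm)
    (ε * μ) upperBad (fun σ => (hub σ).1)
  rw [← hμ] at hlower
  refine _root_.one_sub_le_arrivalProb _ (lowerBad ∪ upperBad) (fun σ hσ => ?_) ?_
  · rw [Finset.mem_union, not_or, hlb, hub, not_not, not_not] at hσ
    simp only [← mul_batch] at hσ
    have hlow := sqrt_le_sv_topProj_mul hsvd.1 hkm hk (half_pos hμ0) hσ.1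
    have hup := sv_le_sqrt (by positivity) hσ.2 1
    refine ⟨le_trans (le_of_eq ?_) hlow, ofReal_sqrt_le_extRatio hμ0 hε hlow hup⟩
    rw [hμ, show (ℓ : ℝ) / n * sv M k ^ 2 / 2 = ℓ / (2 * n) * sv M k ^ 2 by field_simp,
      Real.sqrt_mul (by positivity), Real.sqrt_sq hs.le]
  · have hN : (0 : ℝ) ≤ Fintype.card (Equiv.Perm (Fin n)) := Nat.cast_nonneg _
    -- The margin is 9/11 - 1/2 = 7/22 > 1/4, hence the 40.
    have h1 : (k : ℝ) * Real.exp (-((9 / 11 * μ - μ / 2) / (10 * m))) ≤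
        m * Real.exp (-(μ / (40 * m))) := by
      gcongr ?_ * Real.exp (-?_)
      · exact_mod_cast hkm
      · rw [div_le_div_iff₀ (by positivity) (by positivity)]
        nlinarith [mul_pos hμ0 hm0]
    -- The factor 6 in `hgap` makes the upper tail's centring term at most half of the threshold εμ,
    -- which leaves εμ/2.
    have h2 : (m : ℝ) * Real.exp (-((ε * μ - 3 * (ℓ / n * sv M (k + 1) ^ 2)) / (2 * m))) ≤
        m * Real.exp (-((ε * μ) / (4 * m))) := by
      have h3 : 6 * (ℓ / n * sv M (k + 1) ^ 2) ≤ ε * μ := by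
        rw [hμ]
        have := mul_le_mul_of_nonneg_left hgap (show (0 : ℝ) ≤ ℓ / n by positivity)
        linarith
      gcongr ?_ * Real.exp (-?_)
      rw [div_le_div_iff₀ (by positivity) (by positivity)]
      nlinarith
    calc ((lowerBad ∪ upperBad).card : ℝ) ≤ lowerBad.card + upperBad.card := by
          exact_mod_cast Finset.card_union_le _ _
      _ ≤ _ := add_le_add (hlower.trans (mul_le_mul_of_nonneg_left h1 hN))
          (hupper.trans (mul_le_mul_of_nonneg_left h2 hN))
      _ = _ := by ring

theorem tendsto_div_zero_of_extRatio {ι : Type*} {L : Filter ι} {a b : ι → ℝ}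
    (ha : ∀ᶠ t in L, 0 < a t) (hb : ∀ t, 0 ≤ b t)
    (h : Tendsto (fun t => extRatio (a t) (b t)) L (𝓝 ⊤)) :
    Tendsto (fun t => b t / a t) L (𝓝 0) := by
  have h1 := (ENNReal.tendsto_toReal ENNReal.zero_ne_top).comp
    (ENNReal.inv_top ▸ (tendsto_inv_iff.2 h))
  rw [ENNReal.toReal_zero] at h1
  refine h1.congr' ?_
  filter_upwards [ha] with t ht
  have hne : ENNReal.ofReal (a t) ≠ 0 := by simpa using ht
  rw [Function.comp_apply, extRatio, ENNReal.inv_div (Or.inl ENNReal.ofReal_ne_top) (Or.inr hne),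
    ENNReal.toReal_div, ENNReal.toReal_ofReal (hb t), ENNReal.toReal_ofReal ht.le]

end Sampling

/-! ### Choice of parameters in the limit. -/

theorem mainTheorem5 {ι : Type*} {L : Filter ι} (m n ℓ k : ι → ℕ)
    (hm : Tendsto m L atTop)
    (hℓ1 : ∀ t, 1 ≤ ℓ t) (hℓn : ∀ t, ℓ t ≤ n t)
    (hk1 : ∀ t, 1 ≤ k t) (hkm : ∀ t, k t ≤ m t) (hkn : ∀ t, k t ≤ n t)
    (M : ∀ t, Matrix (Fin (m t)) (Fin (n t)) ℝ)
    (hM : ∀ t i j, M t i j ∈ Set.Icc (0 : ℝ) 1)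
    (U : ∀ t, Matrix (Fin (m t)) (Fin (m t)) ℝ)
    (V : ∀ t, Matrix (Fin (n t)) (Fin (n t)) ℝ)
    (hsvd : ∀ t, IsSVD (M t) (U t) (V t))
    (hs : (fun t => (m t : ℝ) * (n t : ℝ) * Real.log (m t) / (ℓ t : ℝ)) =o[L]
      fun t => sv (M t) (k t) ^ 2)
    (hgap : Tendsto (fun t => extRatio (sv (M t) (k t)) (sv (M t) (k t + 1))) L (𝓝 ⊤)) :
    ∃ w : ι → ℝ, Tendsto w L atTop ∧
      Tendsto (fun t => arrivalProb {σ : Equiv.Perm (Fin (n t)) |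
        Real.sqrt ((ℓ t : ℝ) / (2 * (n t : ℝ))) * sv (M t) (k t)
            ≤ sv (topProj (U t) (hkm t) * batch (M t) (hℓn t) σ) (k t) ∧
        ENNReal.ofReal (w t)
            ≤ extRatio (sv (topProj (U t) (hkm t) * batch (M t) (hℓn t) σ) (k t))
                (sv ((1 - topProj (U t) (hkm t)) * batch (M t) (hℓn t) σ) 1)})
        L (𝓝 1) := by
  have hℓ0 : ∀ t, (0 : ℝ) < ℓ t := fun t => by exact_mod_cast hℓ1 t
  have hn0 : ∀ t, (0 : ℝ) < n t := fun t => by exact_mod_cast (hℓ1 t).trans (hℓn t)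
  have hm2 : ∀ᶠ t in L, 2 ≤ m t := hm.eventually_ge_atTop 2
  have hnum : ∀ᶠ t in L, 0 < (m t : ℝ) * (n t : ℝ) * Real.log (m t) / (ℓ t : ℝ) := by
    filter_upwards [hm2] with t ht
    have h2 : (1 : ℝ) < m t := by exact_mod_cast ht
    have := Real.log_pos h2
    have := hn0 t
    have := hℓ0 t
    positivity
  have hspos : ∀ᶠ t in L, 0 < sv (M t) (k t) := by
    filter_upwards [hs.bound one_pos, hnum] with t h1 h2
    refine (sv_nonneg _ _).lt_of_ne fun h0 => ?_
    rw [← h0] at h1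
    simp only [ne_eq, OfNat.ofNat_ne_zero, not_false_eq_true, zero_pow, norm_zero, mul_zero] at h1
    exact h2.ne' (norm_le_zero_iff.1 h1)
  let a : ι → ℝ := fun t =>
    (m t : ℝ) * (n t : ℝ) * Real.log (m t) / (ℓ t : ℝ) / sv (M t) (k t) ^ 2
  let q : ι → ℝ := fun t => sv (M t) (k t + 1) / sv (M t) (k t)
  -- ε must tend to 0, dominate 6q² for the gap condition, and keep εμ large against m log m, where
  -- μ = (ℓ/n)s_k². As μa = m log m, the summand √a gives εμ ≥ m log m/√a.
  let ε : ι → ℝ := fun t => √(a t) + 6 * q t ^ 2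
  have ha : Tendsto a L (𝓝 0) := hs.tendsto_div_nhds_zero
  have ha' : Tendsto (fun t => √(a t)) L (𝓝 0) := by simpa using ha.sqrt
  have hq : Tendsto q L (𝓝 0) :=
    tendsto_div_zero_of_extRatio hspos (fun t => sv_nonneg _ _) hgap
  have hε : Tendsto ε L (𝓝 0) := by simpa using ha'.add ((hq.pow 2).const_mul 6)
  have hapos : ∀ᶠ t in L, 0 < a t := by
    filter_upwards [hnum, hspos] with t h1 h2
    exact div_pos h1 (pow_pos h2 2)
  have hεpos : ∀ᶠ t in L, 0 < ε t := by
    filter_upwards [hapos] with t h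
    have := Real.sqrt_pos.2 h
    positivity
  refine ⟨fun t => √(1 / (2 * ε t)), ?_, ?_⟩
  · have h1 : Tendsto (fun t => 2 * ε t) L (𝓝[>] 0) :=
      tendsto_nhdsWithin_iff.2 ⟨by simpa using hε.const_mul 2, by
        filter_upwards [hεpos] with t h
        exact mul_pos two_pos h⟩
    simp only [one_div]
    exact Real.tendsto_sqrt_atTop.comp (tendsto_inv_nhdsGT_zero.comp h1)
  · have hinv : Tendsto (fun t => (m t : ℝ)⁻¹) L (𝓝 0) :=
      tendsto_inv_atTop_zero.comp (tendsto_natCast_atTop_atTop.comp hm)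
    have hlim : Tendsto (fun t => 1 - ENNReal.ofReal (2 * (m t : ℝ)⁻¹)) L (𝓝 1) := by
      have h1 := ENNReal.tendsto_ofReal (hinv.const_mul 2)
      simpa using ENNReal.Tendsto.sub tendsto_const_nhds h1 (Or.inl ENNReal.one_ne_top)
    refine tendsto_of_tendsto_of_tendsto_of_le_of_le' hlim tendsto_const_nhds ?_
      (Eventually.of_forall fun t => arrivalProb_le_one _)
    filter_upwards [hm2, hspos, hapos, hεpos, ha'.eventually_le_const (show (0 : ℝ) < 1 / 80 by
      norm_num)] with t ht hst hat hεt hsmall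
    have hm0 : (0 : ℝ) < m t := by exact_mod_cast (two_pos.trans_le ht)
    have hlog : 0 < Real.log (m t) := Real.log_pos (by exact_mod_cast ht)
    have hra : 0 < √(a t) := Real.sqrt_pos.2 hat
    have hsq : √(a t) * √(a t) = a t := Real.mul_self_sqrt hat.le
    have hgap' : 6 * sv (M t) (k t + 1) ^ 2 ≤ ε t * sv (M t) (k t) ^ 2 := by
      have h1 : 6 * sv (M t) (k t + 1) ^ 2 = 6 * q t ^ 2 * sv (M t) (k t) ^ 2 := by
        simp only [q]; field_simp
      rw [h1]
      have : 6 * q t ^ 2 ≤ ε t := le_add_of_nonneg_left hra.le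
      gcongr
    refine le_trans (tsub_le_tsub_left (ENNReal.ofReal_le_ofReal ?_) 1)
      ((hsvd t).one_sub_le_arrivalProb (hM t) (hℓ1 t) (hℓn t) (hk1 t) (hkm t) (hkn t) hst hεt
        hgap')
    have hμ : (ℓ t : ℝ) / n t * sv (M t) (k t) ^ 2 * a t = m t * Real.log (m t) := by
      have := hn0 t
      have := hℓ0 t
      simp only [a]
      field_simp
    set μ : ℝ := (ℓ t : ℝ) / n t * sv (M t) (k t) ^ 2
    have hμr : m t * Real.log (m t) = μ * √(a t) * √(a t) := by rw [mul_assoc, hsq, hμ]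
    have hμ0 : 0 < μ * √(a t) := by
      have : 0 < μ * √(a t) * √(a t) := hμr ▸ mul_pos hm0 hlog
      exact pos_of_mul_pos_left this hra.le
    -- The 80 is twice the 40 of the lower tail's exponent; the upper tail, with its 4, needs less.
    have hb1 : 80 * (m t * Real.log (m t)) ≤ μ * √(a t) := by
      rw [hμr]; nlinarith
    -- One log m cancels the dimension prefactor m, the other leaves the vanishing bound 1/m.
    have hexp : ∀ x, 2 * Real.log (m t) ≤ x → m t * Real.exp (-x) ≤ (m t : ℝ)⁻¹ := by
      intro x hx
      calc m t * Real.exp (-x) ≤ m t * Real.exp (-(Real.log (m t) + Real.log (m t))) := by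
            gcongr; linarith
        _ = (m t : ℝ)⁻¹ := by
            rw [neg_add, Real.exp_add, Real.exp_neg, Real.exp_log hm0]
            field_simp
    have h1 := hexp (μ / (40 * m t)) (by
      rw [le_div_iff₀ (by positivity)]
      have : μ * √(a t) ≤ μ * 1 := by
        have : 0 < μ := pos_of_mul_pos_left hμ0 hra.le
        gcongr; linarith
      linarith)
    have h2 := hexp (ε t * μ / (4 * m t)) (by
      rw [le_div_iff₀ (by positivity)]
      have h3 : √(a t) * μ ≤ ε t * μ := by
        have : 0 < μ := pos_of_mul_pos_left hμ0 hra.le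
        have : √(a t) ≤ ε t := le_add_of_nonneg_right (by positivity)
        gcongr
      nlinarith [mul_pos hm0 hlog])
    linarith
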